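/- Let $n\ge 2$ and let $T_{4n}=\langle a,b\mid a^{2n}=1,\ a^n=b^2,\ b^{-1}ab=a^{-1}\rangle$ be the dicyclic group of order $4n$. Let $S\subseteq T_{4n}$ satisfy $1\notin S$, $S=S^{-1}$ and $gSg^{-1}=S$ for all $g\in T_{4n}$, and let $\mathrm{Cay}(T_{4n},S)$ be the graph with vertex set $T_{4n}$ and edges $\{g,sg\}$, $g\in T_{4n}$, $s\in S$. Let $A$ be its adjacency matrix and $H(t)=\exp(\mathrm{i}tA)$, $t\in\mathbb R$. For distinct vertices $u,v$, say that the graph admits pretty good fractional revival (PGFR) from $u$ to $v$ if there are a sequence $(t_k)$ of real numbers and $\alpha,\beta\in\mathbb C$ with $|\alpha|^2+|\beta|^2=1$, $\beta\neq 0$ and $\lim_{k\to\infty}H(t_k)\mathbf e_u=\alpha\mathbf e_u+\beta\mathbf e_v$. Put $\omega=\exp(\pi\mathrm{i}/n)$, and $\varepsilon=1$ if $n$ is even, $\varepsilon=\mathrm{i}$ if $n$ is odd. Let $\psi_1,\psi_2,\psi_3,\psi_4$ be the representations of $T_{4n}$ of degree one with $(\psi_i(a),\psi_i(b))=(1,1),(1,-1),(-1,\varepsilon),(-1,-\varepsilon)$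 respectively, and for $1\le h\le n-1$ let $\rho_h$ be the representation of degree two with $$\rho_h(a)=\begin{pmatrix}\omega^h&0\\0&\omega^{-h}\end{pmatrix},\qquad \rho_h(b)=\begin{pmatrix}0&1\\ \omega^{hn}&0\end{pmatrix}.$$ Let $\lambda_i=\sum_{s\in S}\psi_i(s)$ $(1\le i\le 4)$ and $\mu_h=\frac12\sum_{s\in S}\operatorname{Tr}\rho_h(s)$ $(1\le h\le n-1)$ be the corresponding eigenvalues of $\mathrm{Cay}(T_{4n},S)$. (a) If $\mathrm{Cay}(T_{4n},S)$ admits PGFR from $u$ to $v$, then $u$ and $v$ lie in the same coset of $\langle a\rangle$ and $v=ua^n$. (b) Let $n$ be odd and $v=ua^n$. Then $\mathrm{Cay}(T_{4n},S)$ admits PGFR from $u$ to $v$ if and only if, for all integers $l'_2,l'_3,l'_4,l_1,\dots,l_{n-1}$, $$\sum_{i=2}^4 l'_i(\lambda_i-\lambda_1)+\sum_{h=1}^{n-1}l_h(\mu_h-\lambda_1)=0\quad\text{implies}\quad l'_3+l'_4+\sum_{h\text{ odd}}l_h\neq\pm1 .$$ (c) Let $n$ be even and $v=ua^n$. Then $\mathrm{Cay}(T_{4n},S)$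 admits PGFR from $u$ to $v$ if and only if, for all integers $l'_2,l'_3,l'_4,l_1,\dots,l_{n-1}$, $$\sum_{i=2}^4 l'_i(\lambda_i-\lambda_1)+\sum_{h=1}^{n-1}l_h(\mu_h-\lambda_1)=0\quad\text{implies}\quad \sum_{h\text{ odd}}l_h\neq\pm1 .$$ Here $\sum_{h\text{ odd}}$ runs over the odd $h$ with $1\le h\le n-1$. -/

import Mathlib

open Filter Topology

/-! ### Continuous-time quantum walks on finite graphs -/

section QuantumWalk

variable {V : Type*} [Fintype V] [DecidableEq V]

/-- The transition matrix `H(t) = exp(i t A)` of a finite graph with adjacency matrix `A`. -/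
noncomputable def transitionMatrix (Γ : SimpleGraph V) [DecidableRel Γ.Adj] (t : ℝ) :
    Matrix V V ℂ :=
  NormedSpace.exp ((Complex.I * (t : ℂ)) • Γ.adjMatrix ℂ)

/-- Pretty good fractional revival from `u` to `v`: the vertices are distinct, and for some real
sequence `t_k` the vectors `H(t_k) e_u` converge to `α e_u + β e_v` with `|α|² + |β|² = 1`.
The case `β = 0` (approximate periodicity at `u`) is excluded. -/
def AdmitsPGFR (Γ : SimpleGraph V) [DecidableRel Γ.Adj] (u v : V) : Prop :=
  u ≠ v ∧ ∃ (t : ℕ → ℝ) (α β : ℂ), ‖α‖ ^ 2 + ‖β‖ ^ 2 = 1 ∧ β ≠ 0 ∧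
    Tendsto (fun k => (transitionMatrix Γ (t k)).mulVec (Pi.single u 1)) atTop
      (𝓝 (α • Pi.single u (1 : ℂ) + β • Pi.single v (1 : ℂ)))

end QuantumWalk

/-- The Cayley graph `Cay(G, S)` with edges `{g, sg}`, `g ∈ G`, `s ∈ S`. (It is used for
inverse-closed `S` with `1 ∉ S`.) -/
def cayleyGraph {G : Type*} [Group G] (S : Finset G) : SimpleGraph G :=
  SimpleGraph.fromRel (fun g g' => ∃ s ∈ S, g' = s * g)

instance cayleyGraph.decidableAdj {G : Type*} [Group G] [DecidableEq G] (S : Finset G) :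
    DecidableRel (cayleyGraph S).Adj :=
  fun g g' => decidable_of_iff
    (g ≠ g' ∧ ((∃ s ∈ S, g' = s * g) ∨ (∃ s ∈ S, g = s * g'))) Iff.rfl

/-- The eigenvalue `(1/d) ∑_{s ∈ S} χ_ρ(s)` of `Cay(G, S)` that corresponds to a
representation `ρ` of degree `d` with character `χ_ρ = tr ∘ ρ`. -/
noncomputable def cayleyEigenvalue {G : Type*} [Group G] {d : ℕ} (S : Finset G)
    (ρ : G →* Matrix (Fin d) (Fin d) ℂ) : ℂ :=
  (1 / (d : ℂ)) * ∑ s ∈ S, (ρ s).trace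

/-! ### The irreducible representations of the dicyclic group

The dicyclic group `T_{4n} = ⟨a, b | a^{2n} = 1, a^n = b², b⁻¹ab = a⁻¹⟩` is Mathlib's
`QuaternionGroup n`, with `a = QuaternionGroup.a 1`, `b = QuaternionGroup.xa 0`; its elements are
`QuaternionGroup.a k = a^k` and `QuaternionGroup.xa k = b a^k`. -/

namespace Dicyclic

section Generators

variable {M : Type*} [Monoid M] {n : ℕ} {A B : M}

theorem pow_val_natCast (h : A ^ (2 * n) = 1) (k : ℕ) :
    A ^ ((k : ZMod (2 * n)).val) = A ^ k := by
  rw [ZMod.val_natCast, ← pow_mod_orderOf, Nat.mod_mod_of_dvd _ (orderOf_dvd_of_pow_eq_one h),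
    pow_mod_orderOf]

theorem pow_val_add [NeZero n] (h : A ^ (2 * n) = 1) (i j : ZMod (2 * n)) :
    A ^ (i + j).val = A ^ i.val * A ^ j.val := by
  rw [← pow_add, ← pow_val_natCast h (i.val + j.val)]
  simp

theorem pow_mul_mul_pow (h : A * B * A = B) (k : ℕ) : A ^ k * B * A ^ k = B := by
  induction k with
  | zero => simp
  | succ k ih =>
    calc A ^ (k + 1) * B * A ^ (k + 1) = A ^ k * (A * B * A) * A ^ k := by
          rw [pow_succ]; nth_rewrite 2 [← pow_succ]; rw [pow_succ']; simp only [mul_assoc]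
      _ = B := by rw [h, ih]

theorem pow_val_mul [NeZero n] (h : A ^ (2 * n) = 1) (h' : A * B * A = B) (i j : ZMod (2 * n)) :
    A ^ i.val * B * A ^ j.val = B * A ^ (j - i).val := by
  have e : A ^ j.val = A ^ i.val * A ^ (j - i).val := by
    rw [← pow_val_add h]; simp
  rw [e, ← mul_assoc, pow_mul_mul_pow h']

/-- The homomorphism from the dicyclic group that maps the generators `a`, `b` to elements
`A`, `B` satisfying the defining relations. -/
def homOfGenerators [NeZero n] (A B : M) (h₁ : A ^ (2 * n) = 1) (h₂ : B * B = A ^ n) (h₃ : A * B * A = B) :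
    QuaternionGroup n →* M where
  toFun
    | QuaternionGroup.a k => A ^ k.val
    | QuaternionGroup.xa k => B * A ^ k.val
  map_one' := by
    rw [QuaternionGroup.one_def]; simp
  map_mul' := by
    rintro (i | i) (j | j)
    · exact pow_val_add h₁ i j
    · simp only [QuaternionGroup.a_mul_xa]
      rw [← mul_assoc, pow_val_mul h₁ h₃]
    · simp only [QuaternionGroup.xa_mul_a]
      rw [pow_val_add h₁, mul_assoc]
    · simp only [QuaternionGroup.xa_mul_xa]
      rw [mul_assoc, ← mul_assoc (A ^ i.val), pow_val_mul h₁ h₃, ← mul_assoc, h₂, add_sub_assoc,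
        pow_val_add h₁, pow_val_natCast h₁]

end Generators

variable (n : ℕ)

/-- `ω = exp(π i / n)`. -/
noncomputable def omega : ℂ := Complex.exp (Real.pi * Complex.I / n)

theorem omega_pow [NeZero n] : omega n ^ (2 * n) = 1 := by
  have hn : (n : ℂ) ≠ 0 := Nat.cast_ne_zero.mpr (NeZero.ne n)
  rw [omega, ← Complex.exp_nat_mul, Complex.exp_eq_one_iff]
  refine ⟨1, ?_⟩
  push_cast
  field_simp

theorem omega_ne_zero : omega n ≠ 0 := Complex.exp_ne_zero _

/-- `ε = 1` for even `n`, and `ε = i` for odd `n`. -/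
noncomputable def eps : ℂ := if Even n then 1 else Complex.I

theorem eps_mul_eps : eps n * eps n = (-1) ^ n := by
  unfold eps
  split_ifs with h
  · simp [h.neg_one_pow]
  · simp [(Nat.not_even_iff_odd.mp h).neg_one_pow]

/-- `∑_{h odd} l_h` over `1 ≤ h ≤ n - 1`. -/
def oddSum (l : ℕ → ℤ) : ℤ := ∑ h ∈ (Finset.Icc 1 (n - 1)).filter Odd, l h

variable [NeZero n]

/-- The representation of degree one with `a ↦ (x)`, `b ↦ (y)`. -/
def linearRep (x y : ℂ) (hx : x * x = 1) (hy : y * y = x ^ n) :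
    QuaternionGroup n →* Matrix (Fin 1) (Fin 1) ℂ :=
  homOfGenerators (Matrix.diagonal fun _ => x) (Matrix.diagonal fun _ => y)
    (by rw [Matrix.diagonal_pow]; ext i j; fin_cases i; fin_cases j; simp [pow_mul, pow_two, hx])
    (by rw [Matrix.diagonal_pow, Matrix.diagonal_mul_diagonal]
        ext i j; fin_cases i; fin_cases j; simp [hy])
    (by rw [Matrix.diagonal_mul_diagonal, Matrix.diagonal_mul_diagonal]
        ext i j; fin_cases i; fin_cases j; simp [mul_right_comm, hx])

/-- `ψ₁ : a ↦ 1, b ↦ 1`. -/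
noncomputable def psi₁ : QuaternionGroup n →* Matrix (Fin 1) (Fin 1) ℂ :=
  linearRep n 1 1 (by simp) (by simp)

/-- `ψ₂ : a ↦ 1, b ↦ -1`. -/
noncomputable def psi₂ : QuaternionGroup n →* Matrix (Fin 1) (Fin 1) ℂ :=
  linearRep n 1 (-1) (by simp) (by simp)

/-- `ψ₃ : a ↦ -1, b ↦ ε`. -/
noncomputable def psi₃ : QuaternionGroup n →* Matrix (Fin 1) (Fin 1) ℂ :=
  linearRep n (-1) (eps n) (by simp) (eps_mul_eps n)

/-- `ψ₄ : a ↦ -1, b ↦ -ε`. -/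
noncomputable def psi₄ : QuaternionGroup n →* Matrix (Fin 1) (Fin 1) ℂ :=
  linearRep n (-1) (-eps n) (by simp) (by rw [neg_mul_neg, eps_mul_eps])

/-- `ρ_h : a ↦ diag(ω^h, ω^{-h}), b ↦ (0, 1; ω^{hn}, 0)`. -/
noncomputable def rho (h : ℕ) : QuaternionGroup n →* Matrix (Fin 2) (Fin 2) ℂ :=
  homOfGenerators (Matrix.diagonal ![omega n ^ h, (omega n ^ h)⁻¹]) !![0, 1; omega n ^ (h * n), 0]
    (by
      have e : (omega n ^ h) ^ (2 * n) = 1 := by rw [pow_right_comm, omega_pow, one_pow]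
      rw [Matrix.diagonal_pow]
      ext i j; fin_cases i <;> fin_cases j <;> simp [e])
    (by
      have e : (omega n ^ h) ^ n * (omega n ^ h) ^ n = 1 := by
        rw [← pow_add, ← two_mul, pow_right_comm, omega_pow, one_pow]
      have e' := eq_inv_of_mul_eq_one_left e
      rw [Matrix.diagonal_pow]
      ext i j; fin_cases i <;> fin_cases j <;> simp [Matrix.mul_apply, Fin.sum_univ_two, pow_mul]
      exact e')
    (by
      have e : omega n ^ h ≠ 0 := pow_ne_zero _ (omega_ne_zero n)
      ext i j; fin_cases i <;> fin_cases j <;>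
        simp [Matrix.mul_apply, Matrix.diagonal, e]
      field_simp)

/-- `l₂(λ₂ - λ₁) + l₃(λ₃ - λ₁) + l₄(λ₄ - λ₁) + ∑_{h=1}^{n-1} l_h (μ_h - λ₁) = 0`, where `λ_i` and
`μ_h` are the eigenvalues of `Cay(T_{4n}, S)` that correspond to `ψ_i` and `ρ_h`. -/
def IsEigenvalueRelation (S : Finset (QuaternionGroup n)) (l₂ l₃ l₄ : ℤ) (l : ℕ → ℤ) : Prop :=
  (l₂ : ℂ) * (cayleyEigenvalue S (psi₂ n) - cayleyEigenvalue S (psi₁ n))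
    + (l₃ : ℂ) * (cayleyEigenvalue S (psi₃ n) - cayleyEigenvalue S (psi₁ n))
    + (l₄ : ℂ) * (cayleyEigenvalue S (psi₄ n) - cayleyEigenvalue S (psi₁ n))
    + ∑ h ∈ Finset.Icc 1 (n - 1),
        (l h : ℂ) * (cayleyEigenvalue S (rho n h) - cayleyEigenvalue S (psi₁ n)) = 0

end Dicyclic

/-! Because `S` is closed under conjugation, each of the listed representations sends the sum over
`S` to a scalar. Its translated characters are therefore eigenvectors of `A`, and the regular
character writes every `e_g` as a combination of them. If `z` is central and acts by `σ i` in
representation `i`, then `H(t_k) e_u → α e_u + β e_{uz}` says exactly that `exp(i t_k θ_i) → α + β σ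
i` for all `i` (`tendsto_transitionMatrix_iff`).

For part (a), the automorphisms `x ↦ h x k` of the graph commute with `H(t)`. Those fixing `u` must
fix `v` too, so `u⁻¹v` is central, and `a^n` is the only nontrivial central element.

For parts (b) and (c), `z = a^n` acts by `-1` on a set `O` of representations and by `1` on the
others, so the phases must tend to `q = α - β` on `O` and to `p = α + β` off it, with `p ≠ q`. An
integer relation among the `θ_i - θ_{i₀}` forces `(q/p)^m = 1`, where `m` is the sum of its
coefficients over `O`; hence `m ≠ ±1`. Conversely, the possible `m` form a subgroup of `ℤ`. If it
omits `1`, it lies in `Nℤ` with `N ≥ 2`, and Kronecker's theorem (`exists_tendsto_torusPoint`) makes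
`q/p = exp(2πi/N)` attainable in the limit. The set `O` consists of the `ρ_h` with `h` odd, together
with `ψ₃`, `ψ₄` when `n` is odd. -/

/-! ### Kronecker's approximation theorem -/

section Kronecker

variable {ι : Type*}

/-- The point of the torus with the given real coordinates modulo one. -/
def torusPoint (x : ι → ℝ) : UnitAddTorus ι := fun i => (x i : UnitAddCircle)

theorem torusPoint_add (x y : ι → ℝ) : torusPoint (x + y) = torusPoint x + torusPoint y := by
  ext i; simp [torusPoint]

theorem continuous_torusPoint : Continuous (torusPoint : (ι → ℝ) → UnitAddTorus ι) :=
  continuous_pi fun i => (AddCircle.continuous_mk' (1 : ℝ)).comp (continuous_apply i)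

theorem mFourier_torusPoint [Fintype ι] (l : ι → ℤ) (x : ι → ℝ) :
    UnitAddTorus.mFourier l (torusPoint x) =
      Complex.exp (2 * Real.pi * Complex.I * ((∑ i, (l i : ℝ) * x i : ℝ) : ℂ)) := by
  simp only [UnitAddTorus.mFourier, ContinuousMap.coe_mk, torusPoint, fourier_coe_apply]
  rw [← Complex.exp_sum]
  congr 1
  push_cast
  rw [Finset.mul_sum]
  exact Finset.sum_congr rfl fun i _ => by simp; ring

/-- The mean over `[0, T]` of the difference between a function along the line through `w` with
direction `x` and along the parallel line through the origin. -/
noncomputable def meanDifference (x w : ι → ℝ) (f : C(UnitAddTorus ι, ℂ)) (T : ℝ) : ℂ :=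
  (T : ℂ)⁻¹ * ∫ t in (0 : ℝ)..T, (f (torusPoint (w + t • x)) - f (torusPoint (t • x)))

theorem continuous_torusPoint_line (w x : ι → ℝ) :
    Continuous fun t : ℝ => torusPoint (w + t • x) :=
  continuous_torusPoint.comp (by fun_prop)

theorem continuous_torusPoint_smul (x : ι → ℝ) :
    Continuous fun t : ℝ => torusPoint (t • x) :=
  continuous_torusPoint.comp (by fun_prop)

theorem continuous_lineDifference (x w : ι → ℝ) (f : C(UnitAddTorus ι, ℂ)) :
    Continuous fun t : ℝ => f (torusPoint (w + t • x)) - f (torusPoint (t • x)) :=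
  (f.continuous.comp (continuous_torusPoint_line w x)).sub
    (f.continuous.comp (continuous_torusPoint_smul x))

theorem meanDifference_add (x w : ι → ℝ) (f g : C(UnitAddTorus ι, ℂ)) (T : ℝ) :
    meanDifference x w (f + g) T = meanDifference x w f T + meanDifference x w g T := by
  unfold meanDifference
  rw [← mul_add, ← intervalIntegral.integral_add
    ((continuous_lineDifference x w f).intervalIntegrable _ _)
    ((continuous_lineDifference x w g).intervalIntegrable _ _)]
  congr 2
  ext t
  simp only [ContinuousMap.add_apply]
  ring

theorem meanDifference_smul (x w : ι → ℝ) (c : ℂ) (f : C(UnitAddTorus ι, ℂ)) (T : ℝ) :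
    meanDifference x w (c • f) T = c * meanDifference x w f T := by
  unfold meanDifference
  simp only [ContinuousMap.smul_apply, smul_eq_mul, ← mul_sub]
  rw [intervalIntegral.integral_const_mul, mul_left_comm]

theorem norm_meanDifference_le (x w : ι → ℝ) (f : C(UnitAddTorus ι, ℂ)) {T : ℝ} (hT : 0 < T) :
    ‖meanDifference x w f T‖ ≤ 2 * ‖f‖ := by
  have h : ‖∫ t in (0 : ℝ)..T, (f (torusPoint (w + t • x)) - f (torusPoint (t • x)))‖
      ≤ (2 * ‖f‖) * |T - 0| := by
    refine intervalIntegral.norm_integral_le_of_norm_le_const fun t _ => ?_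
    calc _ ≤ ‖f (torusPoint (w + t • x))‖ + ‖f (torusPoint (t • x))‖ := norm_sub_le _ _
      _ ≤ ‖f‖ + ‖f‖ := add_le_add (f.norm_coe_le_norm _) (f.norm_coe_le_norm _)
      _ = 2 * ‖f‖ := by ring
  rw [sub_zero, abs_of_pos hT] at h
  rw [meanDifference, norm_mul, norm_inv, Complex.norm_real, Real.norm_eq_abs, abs_of_pos hT,
    inv_mul_le_iff₀ hT, mul_comm T]
  exact h

/-- Along the two lines a character differs by `(e - 1) exp(c t)`. Either `c = 0`, and the
hypothesis on relations gives `e = 1`, or the integral stays bounded and the factor `1/T` kills it.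
-/
theorem tendsto_meanDifference_mFourier [Fintype ι] (x w : ι → ℝ)
    (h : ∀ l : ι → ℤ, ∑ i, (l i : ℝ) * x i = 0 → ∃ m : ℤ, ∑ i, (l i : ℝ) * w i = m)
    (l : ι → ℤ) :
    Tendsto (meanDifference x w (UnitAddTorus.mFourier l)) atTop (𝓝 0) := by
  set r : ℝ := ∑ i, (l i : ℝ) * x i with hr
  set e : ℂ := Complex.exp (2 * Real.pi * Complex.I * ((∑ i, (l i : ℝ) * w i : ℝ) : ℂ)) with he
  set c : ℂ := 2 * Real.pi * Complex.I * (r : ℂ) with hc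
  have key : ∀ t : ℝ, UnitAddTorus.mFourier l (torusPoint (w + t • x))
      - UnitAddTorus.mFourier l (torusPoint (t • x)) = (e - 1) * Complex.exp (c * t) := by
    intro t
    have h1 : ∑ i, (l i : ℝ) * (w + t • x) i = (∑ i, (l i : ℝ) * w i) + r * t := by
      rw [hr, Finset.sum_mul, ← Finset.sum_add_distrib]
      exact Finset.sum_congr rfl fun i _ => by simp; ring
    have h2 : ∑ i, (l i : ℝ) * (t • x) i = r * t := by
      rw [hr, Finset.sum_mul]
      exact Finset.sum_congr rfl fun i _ => by simp; ring
    rw [mFourier_torusPoint, mFourier_torusPoint, h1, h2, Complex.ofReal_add, mul_add,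
      Complex.exp_add, ← he, sub_mul, one_mul, hc, Complex.ofReal_mul, ← mul_assoc]
  have hmean : ∀ T : ℝ, meanDifference x w (UnitAddTorus.mFourier l) T
      = (T : ℂ)⁻¹ * ((e - 1) * ∫ t in (0 : ℝ)..T, Complex.exp (c * t)) := by
    intro T
    simp only [meanDifference, key, intervalIntegral.integral_const_mul]
  by_cases h0 : r = 0
  · obtain ⟨m, hm⟩ := h l h0
    have he1 : e = 1 := by
      rw [he, hm, Complex.exp_eq_one_iff]
      exact ⟨m, by push_cast; ring⟩
    simp [funext hmean, he1]
  · have hc0 : c ≠ 0 := by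
      simp [hc, h0, Real.pi_ne_zero]
    have hexp : ∀ T : ℝ, ‖Complex.exp (c * T)‖ = 1 := by
      intro T
      have : c * T = ((2 * Real.pi * r * T : ℝ) : ℂ) * Complex.I := by
        rw [hc]; push_cast; ring
      rw [this, Complex.norm_exp_ofReal_mul_I]
    have hinv : Tendsto (fun T : ℝ => |T|⁻¹ * (‖e - 1‖ * (2 / ‖c‖))) atTop (𝓝 0) := by
      simpa using (tendsto_inv_atTop_zero.comp tendsto_abs_atTop_atTop).mul_const
        (‖e - 1‖ * (2 / ‖c‖))
    refine squeeze_zero_norm (fun T => ?_) hinv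
    rw [hmean, integral_exp_mul_complex hc0, norm_mul, norm_inv, Complex.norm_real,
      Real.norm_eq_abs, norm_mul, norm_div]
    gcongr
    refine (norm_sub_le _ _).trans ?_
    rw [hexp, hexp]
    norm_num

/-- Trigonometric polynomials are uniformly dense, and the mean difference is bounded by twice the
sup norm, uniformly in `T > 0`, so the case of characters suffices. -/
theorem tendsto_meanDifference [Fintype ι] (x w : ι → ℝ)
    (h : ∀ l : ι → ℤ, ∑ i, (l i : ℝ) * x i = 0 → ∃ m : ℤ, ∑ i, (l i : ℝ) * w i = m)
    (f : C(UnitAddTorus ι, ℂ)) :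
    Tendsto (meanDifference x w f) atTop (𝓝 0) := by
  have hspan : ∀ g ∈ Submodule.span ℂ (Set.range (UnitAddTorus.mFourier (d := ι))),
      Tendsto (meanDifference x w g) atTop (𝓝 0) := by
    intro g hg
    induction hg using Submodule.span_induction with
    | mem g hg =>
      obtain ⟨l, rfl⟩ := hg
      exact tendsto_meanDifference_mFourier x w h l
    | zero =>
      have h0 : meanDifference x w 0 = fun _ => 0 := by ext T; simp [meanDifference]
      rw [h0]
      exact tendsto_const_nhds
    | add f g _ _ hf hg =>
      rw [funext (meanDifference_add x w f g)]
      simpa using hf.add hg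
    | smul c f _ hf =>
      rw [funext (meanDifference_smul x w c f)]
      simpa using hf.const_mul c
  have hf : f ∈ (Submodule.span ℂ
      (Set.range (UnitAddTorus.mFourier (d := ι)))).topologicalClosure := by
    rw [UnitAddTorus.span_mFourier_closure_eq_top]; trivial
  rw [← SetLike.mem_coe, Submodule.topologicalClosure_coe, Metric.mem_closure_iff] at hf
  rw [Metric.tendsto_nhds]
  intro ε hε
  obtain ⟨g, hg, hfg⟩ := hf (ε / 4) (by positivity)
  filter_upwards [(Metric.tendsto_nhds.mp (hspan g hg)) (ε / 2) (by positivity),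
    eventually_gt_atTop 0] with T hT hT0
  rw [dist_zero_right] at hT ⊢
  have hsplit : meanDifference x w f T
      = meanDifference x w g T + meanDifference x w (f - g) T := by
    rw [← meanDifference_add, add_sub_cancel]
  have hle := norm_meanDifference_le x w (f - g) hT0
  rw [dist_eq_norm] at hfg
  calc _ ≤ ‖meanDifference x w g T‖ + ‖meanDifference x w (f - g) T‖ := by
        rw [hsplit]; exact norm_add_le _ _
    _ < ε := by linarith

/-- Kronecker's theorem: if every integer relation between the coordinates of `x` is a relation
modulo one between the coordinates of `w`, then `w` is, modulo one, a limit of multiples of `x`. -/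
theorem exists_tendsto_torusPoint [Fintype ι] (x w : ι → ℝ)
    (h : ∀ l : ι → ℤ, ∑ i, (l i : ℝ) * x i = 0 → ∃ m : ℤ, ∑ i, (l i : ℝ) * w i = m) :
    ∃ t : ℕ → ℝ, Tendsto (fun k => torusPoint (t k • x)) atTop (𝓝 (torusPoint w)) := by
  set K : Set (UnitAddTorus ι) := closure (Set.range fun t : ℝ => torusPoint (t • x)) with hK
  by_cases hw : torusPoint w ∈ K
  · obtain ⟨y, hy, hlim⟩ := mem_closure_iff_seq_limit.mp hw
    choose t ht using hy
    exact ⟨t, by simpa only [ht] using hlim⟩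
  exfalso
  have hadd : ∀ y ∈ K, ∀ s : ℝ, y + torusPoint (s • x) ∈ K := by
    intro y hy s
    refine map_mem_closure (f := fun y => y + torusPoint (s • x)) (by fun_prop) hy ?_
    rintro _ ⟨t, rfl⟩
    exact ⟨t + s, by simp only [add_smul, torusPoint_add]⟩
  -- `K` is closed under differences and `L` lies in the coset `w + K`, so a common point would put
  -- `w` in `K`. A Urysohn function separating `K` from `L` then has mean difference constantly `1`,
  -- against the limit `0`.
  set L : Set (UnitAddTorus ι) := closure (Set.range fun t : ℝ => torusPoint (w + t • x)) with hL
  have hsub : ∀ y ∈ L, y - torusPoint w ∈ K := by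
    intro y hy
    refine map_mem_closure (f := fun y => y - torusPoint w) (by fun_prop) hy ?_
    rintro _ ⟨t, rfl⟩
    exact ⟨t, by simp only [torusPoint_add]; abel⟩
  have hdisj : Disjoint K L := by
    rw [Set.disjoint_left]
    intro y hyK hyL
    have hz := hsub y hyL
    apply hw
    have hmem : y - (y - torusPoint w) ∈ K := by
      refine map_mem_closure₂ (f := fun a b => a - b) (by fun_prop) hyK hz ?_
      rintro _ ⟨s, rfl⟩ _ ⟨t, rfl⟩
      refine ⟨s - t, ?_⟩
      simp only
      rw [eq_sub_iff_add_eq, ← torusPoint_add, ← add_smul, sub_add_cancel]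
    simpa using hmem
  obtain ⟨f, hf0, hf1, -⟩ := exists_continuous_zero_one_of_isClosed (X := UnitAddTorus ι)
    isClosed_closure isClosed_closure hdisj
  set g : C(UnitAddTorus ι, ℂ) := ⟨fun y => (f y : ℂ), by fun_prop⟩ with hg
  have hone : ∀ᶠ T in atTop, meanDifference x w g T = 1 := by
    filter_upwards [eventually_gt_atTop 0] with T hT
    have e : ∀ t : ℝ, g (torusPoint (w + t • x)) - g (torusPoint (t • x)) = 1 := by
      intro t
      have h0 : f (torusPoint (t • x)) = 0 := hf0 (subset_closure ⟨t, rfl⟩)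
      have h1 : f (torusPoint (w + t • x)) = 1 := hf1 (subset_closure ⟨t, rfl⟩)
      simp [hg, h0, h1]
    simp [meanDifference, e, hT.ne']
  have := tendsto_nhds_unique (tendsto_meanDifference x w h g)
    (tendsto_const_nhds.congr' (hone.mono fun _ h => h.symm))
  exact zero_ne_one this

end Kronecker

/-! ### Eigenvectors and the transition matrix -/

section Transition

variable {V : Type*} [Fintype V]

-- The adjacency matrix is Hermitian. Reality of the eigenvalues is what makes the phases unimodular
-- and Kronecker's theorem applicable.
open scoped ComplexOrder in
theorem conj_eigenvalue_adjMatrix {Γ : SimpleGraph V} [DecidableRel Γ.Adj] {f : V → ℂ} {θ : ℂ}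
    (h : (Γ.adjMatrix ℂ).mulVec f = θ • f) (hf : f ≠ 0) : (starRingEnd ℂ) θ = θ := by
  have hA : (Γ.adjMatrix ℂ).conjTranspose = Γ.adjMatrix ℂ := by
    ext i j
    simp [Matrix.conjTranspose_apply, SimpleGraph.adjMatrix_apply, Γ.adj_comm i j, apply_ite]
  have h1 : star f ⬝ᵥ (Γ.adjMatrix ℂ).mulVec f = θ * (star f ⬝ᵥ f) := by
    rw [h, dotProduct_smul, smul_eq_mul]
  have h2 : star f ⬝ᵥ (Γ.adjMatrix ℂ).mulVec f = star θ * (star f ⬝ᵥ f) := by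
    rw [Matrix.dotProduct_mulVec]
    nth_rewrite 1 [← hA]
    rw [← Matrix.star_mulVec, h, star_smul, smul_dotProduct, smul_eq_mul]
  have h0 : star f ⬝ᵥ f ≠ 0 := fun e => hf (dotProduct_star_self_eq_zero.mp e)
  exact mul_right_cancel₀ h0 (h2.symm.trans h1)

variable [DecidableEq V]

open scoped Matrix.Norms.Operator in
theorem exp_smul_mulVec_of_eigenvector {M : Matrix V V ℂ} {v : V → ℂ} {θ : ℂ}
    (h : M.mulVec v = θ • v) (c : ℂ) :
    (NormedSpace.exp (c • M)).mulVec v = Complex.exp (c * θ) • v := by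
  have hpow : ∀ k : ℕ, (M ^ k).mulVec v = θ ^ k • v := by
    intro k
    induction k with
    | zero => simp
    | succ k ih => rw [pow_succ, ← Matrix.mulVec_mulVec, h, Matrix.mulVec_smul, ih, smul_smul,
        pow_succ']
  have h1 := NormedSpace.exp_series_hasSum_exp' (𝕂 := ℂ) (c • M)
  have h2 : HasSum (fun k : ℕ => (((k.factorial : ℂ)⁻¹ • (c • M) ^ k) : Matrix V V ℂ).mulVec v)
      ((NormedSpace.exp (c • M)).mulVec v) :=
    h1.map (⟨⟨fun N : Matrix V V ℂ => N.mulVec v, Matrix.zero_mulVec v⟩,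
      fun A B => Matrix.add_mulVec A B v⟩ : Matrix V V ℂ →+ (V → ℂ))
      (continuous_id.matrix_mulVec continuous_const)
  have h3 := (NormedSpace.exp_series_hasSum_exp' (𝕂 := ℂ) (c * θ)).smul_const v
  rw [← Complex.exp_eq_exp_ℂ] at h3
  refine h2.unique (h3.congr_fun ?_)
  intro k
  rw [smul_pow, Matrix.smul_mulVec, Matrix.smul_mulVec, hpow, smul_smul, smul_smul, mul_pow,
    smul_eq_mul]
  ring_nf

variable (Γ : SimpleGraph V) [DecidableRel Γ.Adj]

theorem transitionMatrix_isSymm (t : ℝ) : (transitionMatrix Γ t).IsSymm :=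
  ((SimpleGraph.isSymm_adjMatrix Γ).smul _).exp

variable {Γ}

/-- `H(t)` is symmetric, so it can be moved onto the eigenvector `f` without conjugation. -/
theorem dotProduct_transitionMatrix_mulVec {f : V → ℂ} {θ : ℂ}
    (h : (Γ.adjMatrix ℂ).mulVec f = θ • f) (t : ℝ) (u : V) :
    f ⬝ᵥ (transitionMatrix Γ t).mulVec (Pi.single u 1) = Complex.exp (Complex.I * t * θ) * f u := by
  rw [Matrix.dotProduct_mulVec, ← Matrix.mulVec_transpose, (transitionMatrix_isSymm Γ t).eq,
    transitionMatrix, exp_smul_mulVec_of_eigenvector h]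
  simp

open scoped Matrix.Norms.Operator in
/-- The transition matrix is invariant under graph automorphisms. -/
theorem transitionMatrix_apply_iso (φ : Γ ≃g Γ) (t : ℝ) (x y : V) :
    transitionMatrix Γ t (φ x) (φ y) = transitionMatrix Γ t x y := by
  have hA : Matrix.reindexAlgEquiv ℂ ℂ φ.toEquiv
      ((Complex.I * (t : ℂ)) • Γ.adjMatrix ℂ) = (Complex.I * (t : ℂ)) • Γ.adjMatrix ℂ := by
    rw [map_smul]
    congr 1
    exact SimpleGraph.Iso.reindex_adjMatrix ℂ φ
  have h : Matrix.reindexAlgEquiv ℂ ℂ φ.toEquiv (transitionMatrix Γ t) = transitionMatrix Γ t := by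
    have hc : Continuous (Matrix.reindexAlgEquiv ℂ ℂ φ.toEquiv) :=
      continuous_id.matrix_reindex φ.toEquiv φ.toEquiv
    have := NormedSpace.map_exp (Matrix.reindexAlgEquiv ℂ ℂ φ.toEquiv) hc
      ((Complex.I * (t : ℂ)) • Γ.adjMatrix ℂ)
    rwa [hA] at this
  have h' := congr_fun (congr_fun h (φ x)) (φ y)
  rw [← h']
  change transitionMatrix Γ t (φ.symm (φ x)) (φ.symm (φ y)) = _
  simp

end Transition

/-! ### Cayley graphs with a conjugation-invariant connection set -/

section Cayley

variable {G : Type*} [Group G] {S : Finset G}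

theorem cayleyGraph_adj_iff (hone : 1 ∉ S) (hinv : ∀ s ∈ S, s⁻¹ ∈ S) (g g' : G) :
    (cayleyGraph S).Adj g g' ↔ g' * g⁻¹ ∈ S := by
  have h1 : ∀ x y : G, (∃ s ∈ S, y = s * x) ↔ y * x⁻¹ ∈ S := fun x y =>
    ⟨by rintro ⟨s, hs, rfl⟩; simpa using hs, fun h => ⟨_, h, by simp⟩⟩
  rw [cayleyGraph, SimpleGraph.fromRel_adj, h1, h1]
  constructor
  · rintro ⟨-, h | h⟩
    · exact h
    · simpa using hinv _ h
  · intro h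
    refine ⟨?_, Or.inl h⟩
    rintro rfl
    exact hone (by simpa using h)

/-- The automorphism `x ↦ h x k` of a Cayley graph. -/
def cayleyGraphIso (hone : 1 ∉ S) (hinv : ∀ s ∈ S, s⁻¹ ∈ S)
    (hconj : ∀ g : G, ∀ s ∈ S, g * s * g⁻¹ ∈ S) (h k : G) : cayleyGraph S ≃g cayleyGraph S where
  toEquiv := (Equiv.mulLeft h).trans (Equiv.mulRight k)
  map_rel_iff' := by
    intro x y
    rw [cayleyGraph_adj_iff hone hinv, cayleyGraph_adj_iff hone hinv]
    have e : h * y * k * (h * x * k)⁻¹ = h * (y * x⁻¹) * h⁻¹ := by group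
    simp only [Equiv.trans_apply, Equiv.coe_mulLeft, Equiv.coe_mulRight, e]
    refine ⟨fun H => ?_, hconj _ _⟩
    have := hconj h⁻¹ _ H
    rwa [show h⁻¹ * (h * (y * x⁻¹) * h⁻¹) * h⁻¹⁻¹ = y * x⁻¹ by group] at this

variable [Fintype G] [DecidableEq G]

/-- Fractional revival in a conjugation-invariant Cayley graph occurs only between vertices that
differ by a central element. -/
theorem AdmitsPGFR.mem_center (hone : 1 ∉ S) (hinv : ∀ s ∈ S, s⁻¹ ∈ S)
    (hconj : ∀ g : G, ∀ s ∈ S, g * s * g⁻¹ ∈ S) {u v : G}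
    (h : AdmitsPGFR (cayleyGraph S) u v) : u⁻¹ * v ∈ Subgroup.center G := by
  obtain ⟨huv, t, α, β, -, hβ, hlim⟩ := h
  rw [Subgroup.mem_center_iff]
  intro g
  -- This automorphism fixes `u` and sends `u c` to `u (g c g⁻¹)`. The limit vector has equal
  -- entries at `v` and `φ v`; were these distinct, the entry at `φ v` would be `0`, whereas the one
  -- at `v` is `β`.
  set φ := cayleyGraphIso hone hinv hconj (u * g * u⁻¹) g⁻¹ with hφ
  have hφu : φ u = u := by
    change u * g * u⁻¹ * u * g⁻¹ = u
    group
  have hφv : φ v = u * (g * (u⁻¹ * v) * g⁻¹) := by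
    change u * g * u⁻¹ * v * g⁻¹ = _
    group
  have hcoord : ∀ x : G, Tendsto (fun k => transitionMatrix (cayleyGraph S) (t k) x u) atTop
      (𝓝 ((α • Pi.single u (1 : ℂ) + β • Pi.single v (1 : ℂ) : G → ℂ) x)) := by
    intro x
    simpa using (tendsto_pi_nhds.mp hlim) x
  have hv := hcoord v
  have hv' := hcoord (φ v)
  have hinvt : ∀ k, transitionMatrix (cayleyGraph S) (t k) (φ v) u
      = transitionMatrix (cayleyGraph S) (t k) v u := by
    intro k
    nth_rewrite 1 [← hφu]
    exact transitionMatrix_apply_iso φ (t k) v u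
  simp only [hinvt] at hv'
  have heq := tendsto_nhds_unique hv hv'
  have hne : φ v ≠ u := fun e => huv (φ.injective (hφu.trans e.symm))
  have hfix : φ v = v := by
    by_contra hne'
    apply hβ
    simpa [Pi.single_apply, huv.symm, hne, hne'] using heq
  rw [hφv] at hfix
  have e : g * (u⁻¹ * v) * g⁻¹ = u⁻¹ * v := by rw [eq_inv_mul_iff_mul_eq, hfix]
  exact mul_inv_eq_iff_eq_mul.mp e

theorem adjMatrix_cayleyGraph_mulVec (hone : 1 ∉ S) (hinv : ∀ s ∈ S, s⁻¹ ∈ S) (f : G → ℂ)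
    (g : G) : ((cayleyGraph S).adjMatrix ℂ).mulVec f g = ∑ s ∈ S, f (s * g) := by
  simp only [Matrix.mulVec, dotProduct, SimpleGraph.adjMatrix_apply,
    cayleyGraph_adj_iff hone hinv, ite_mul, one_mul, zero_mul]
  rw [← Finset.sum_filter]
  refine Finset.sum_bij' (fun x _ => x * g⁻¹) (fun s _ => s * g) ?_ ?_ ?_ ?_ ?_ <;> simp

/-- Applying `A` inserts the scalar matrix `∑ ρ s` between `ρ g⁻¹` and `ρ x` under the trace. -/
theorem adjMatrix_mulVec_character (hone : 1 ∉ S) (hinv : ∀ s ∈ S, s⁻¹ ∈ S) {d : ℕ}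
    {ρ : G →* Matrix (Fin d) (Fin d) ℂ}
    (hρ : ∑ s ∈ S, ρ s = cayleyEigenvalue S ρ • (1 : Matrix (Fin d) (Fin d) ℂ)) (g : G) :
    ((cayleyGraph S).adjMatrix ℂ).mulVec (fun x => (ρ (g⁻¹ * x)).trace)
      = cayleyEigenvalue S ρ • fun x => (ρ (g⁻¹ * x)).trace := by
  ext x
  rw [adjMatrix_cayleyGraph_mulVec hone hinv]
  have : ∀ s, (ρ (g⁻¹ * (s * x))).trace = (ρ g⁻¹ * ρ s * ρ x).trace := by
    intro s; rw [map_mul, map_mul, mul_assoc]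
  simp only [this]
  rw [← Matrix.trace_sum, ← Finset.sum_mul, ← Finset.mul_sum, hρ]
  simp

theorem conj_cayleyEigenvalue (hone : 1 ∉ S) (hinv : ∀ s ∈ S, s⁻¹ ∈ S) {d : ℕ} (hd : d ≠ 0)
    {ρ : G →* Matrix (Fin d) (Fin d) ℂ}
    (hρ : ∑ s ∈ S, ρ s = cayleyEigenvalue S ρ • (1 : Matrix (Fin d) (Fin d) ℂ)) :
    (starRingEnd ℂ) (cayleyEigenvalue S ρ) = cayleyEigenvalue S ρ := by
  refine conj_eigenvalue_adjMatrix (adjMatrix_mulVec_character hone hinv hρ 1) fun h => ?_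
  have := congr_fun h 1
  simp [hd] at this

variable {ι : Type*} [Fintype ι] {d : ι → ℕ} {ρ : ∀ i, G →* Matrix (Fin (d i)) (Fin (d i)) ℂ}

/-- For a complete family of representations, on which a central element `z` acts by the scalars
`σ i`, fractional revival along a sequence of times is a condition on the eigenvalues. -/
theorem tendsto_transitionMatrix_iff (hone : 1 ∉ S) (hinv : ∀ s ∈ S, s⁻¹ ∈ S) (hd : ∀ i, d i ≠ 0)
    (hρ : ∀ i, ∑ s ∈ S, ρ i s = cayleyEigenvalue S (ρ i) • (1 : Matrix (Fin (d i)) (Fin (d i)) ℂ))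
    (hreg : ∀ x, ∑ i, (d i : ℂ) * (ρ i x).trace = if x = 1 then (Fintype.card G : ℂ) else 0)
    {z : G} {σ : ι → ℂ} (hσ : ∀ i, ρ i z = σ i • 1) (u : G) (t : ℕ → ℝ) (α β : ℂ) :
    Tendsto (fun k => (transitionMatrix (cayleyGraph S) (t k)).mulVec (Pi.single u 1)) atTop
        (𝓝 (α • Pi.single u (1 : ℂ) + β • Pi.single (u * z) (1 : ℂ))) ↔
      ∀ i, Tendsto (fun k => Complex.exp (Complex.I * t k * cayleyEigenvalue S (ρ i))) atTop
        (𝓝 (α + β * σ i)) := by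
  have htr : ∀ i x, (ρ i (x * z)).trace = σ i * (ρ i x).trace := by
    intro i x; rw [map_mul, hσ]; simp
  constructor
  · intro h i
    set f : G → ℂ := fun x => (ρ i (u⁻¹ * x)).trace with hf
    have hcont : Continuous fun w : G → ℂ => f ⬝ᵥ w := by fun_prop
    have h1 := (hcont.tendsto _).comp h
    have hfu : f u = d i := by simp only [hf, inv_mul_cancel, map_one]; simp
    have hfz : f (u * z) = σ i * d i := by simp only [hf, ← mul_assoc, htr, inv_mul_cancel, map_one]; simp
    have h2 : f ⬝ᵥ (α • Pi.single u (1 : ℂ) + β • Pi.single (u * z) (1 : ℂ))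
        = (α + β * σ i) * d i := by
      rw [dotProduct_add, dotProduct_smul, dotProduct_smul, dotProduct_single, dotProduct_single,
        hfu, hfz, smul_eq_mul, smul_eq_mul]
      ring
    rw [h2] at h1
    have h3 : ((fun w : G → ℂ => f ⬝ᵥ w) ∘ fun k =>
        (transitionMatrix (cayleyGraph S) (t k)).mulVec (Pi.single u 1))
        = fun k => Complex.exp (Complex.I * t k * cayleyEigenvalue S (ρ i)) * d i := by
      ext k
      rw [Function.comp_apply, dotProduct_transitionMatrix_mulVec
        (adjMatrix_mulVec_character hone hinv (hρ i) u), ← hfu]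
    rw [h3] at h1
    have hd' : (d i : ℂ) ≠ 0 := Nat.cast_ne_zero.mpr (hd i)
    simpa [hd'] using h1.mul_const (d i : ℂ)⁻¹
  · intro h
    rw [tendsto_pi_nhds]
    intro g
    have hcard : (Fintype.card G : ℂ) ≠ 0 := Nat.cast_ne_zero.mpr Fintype.card_ne_zero
    -- Translate of the regular character identity `hreg`; it turns convergence against characters
    -- into coordinatewise convergence.
    have hsingle : (Pi.single g 1 : G → ℂ) = (Fintype.card G : ℂ)⁻¹ •
        ∑ i, (d i : ℂ) • fun x => (ρ i (g⁻¹ * x)).trace := by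
      ext x
      simp only [Pi.smul_apply, Finset.sum_apply, smul_eq_mul, hreg, inv_mul_eq_one]
      rw [Pi.single_apply]
      by_cases e : x = g
      · simp [e, hcard]
      · simp [e, Ne.symm e]
    have hcoord : ∀ w : G → ℂ, w g = (Pi.single g 1 : G → ℂ) ⬝ᵥ w := by simp
    have hexp : ∀ w : G → ℂ, w g = (Fintype.card G : ℂ)⁻¹ *
        ∑ i, (d i : ℂ) * ((fun x => (ρ i (g⁻¹ * x)).trace) ⬝ᵥ w) := by
      intro w
      rw [hcoord w, hsingle, smul_dotProduct, smul_eq_mul, sum_dotProduct]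
      simp only [smul_dotProduct, smul_eq_mul]
    have hlim : (α • Pi.single u (1 : ℂ) + β • Pi.single (u * z) (1 : ℂ) : G → ℂ) g
        = (Fintype.card G : ℂ)⁻¹ * ∑ i, (d i : ℂ) * ((α + β * σ i) * (ρ i (g⁻¹ * u)).trace) := by
      refine (hexp _).trans ?_
      congr 1
      refine Finset.sum_congr rfl fun i _ => ?_
      rw [dotProduct_add, dotProduct_smul, dotProduct_smul, dotProduct_single, dotProduct_single,
        ← mul_assoc g⁻¹, htr, smul_eq_mul, smul_eq_mul]
      ring
    rw [hlim]
    have hk : ∀ k, (transitionMatrix (cayleyGraph S) (t k)).mulVec (Pi.single u 1) g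
        = (Fintype.card G : ℂ)⁻¹ * ∑ i, (d i : ℂ) *
          (Complex.exp (Complex.I * t k * cayleyEigenvalue S (ρ i)) * (ρ i (g⁻¹ * u)).trace) := by
      intro k
      refine (hexp _).trans ?_
      simp only [dotProduct_transitionMatrix_mulVec
        (adjMatrix_mulVec_character hone hinv (hρ _) g)]
    simp only [hk]
    exact (tendsto_finsetSum _ fun i _ => ((h i).mul_const _).const_mul _).const_mul _

end Cayley

/-! ### Fractional revival in terms of integer relations between eigenvalues -/

section Relations

/-- A group of integers that does not contain `1` has a common divisor `N ≥ 2`. -/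
theorem exists_two_le_dvd_of_one_notMem (L : AddSubgroup ℤ) (h : (1 : ℤ) ∉ L) :
    ∃ N : ℕ, 2 ≤ N ∧ ∀ m ∈ L, (N : ℤ) ∣ m := by
  obtain ⟨a, ha⟩ := Int.subgroup_cyclic L
  have hmem : ∀ m ∈ L, a ∣ m := by
    intro m hm
    rw [ha, AddSubgroup.mem_closure_singleton] at hm
    obtain ⟨c, rfl⟩ := hm
    exact ⟨c, by rw [smul_eq_mul, mul_comm]⟩
  have haL : a ∈ L := by rw [ha]; exact AddSubgroup.subset_closure rfl
  have hne : a.natAbs ≠ 1 := by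
    intro e
    rcases Int.natAbs_eq_iff.mp e with e | e
    · exact h (by simpa [e] using haL)
    · exact h (by simpa [e] using neg_mem haL)
  -- The least prime factor, rather than the generator itself, also covers the zero subgroup, since
  -- `Nat.minFac 0 = 2`.
  exact ⟨a.natAbs.minFac, (Nat.minFac_prime hne).two_le, fun m hm =>
    (Int.natCast_dvd.mpr (Nat.minFac_dvd _)).trans (hmem m hm)⟩

theorem zpow_sum_of_ne_zero {ι K : Type*} [CommGroupWithZero K] {x : K} (hx : x ≠ 0)
    (s : Finset ι) (f : ι → ℤ) : x ^ (∑ i ∈ s, f i) = ∏ i ∈ s, x ^ f i := by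
  induction s using Finset.cons_induction with
  | empty => simp
  | cons i s hi ih => rw [Finset.sum_cons, Finset.prod_cons, zpow_add₀ hx, ih]

variable {ι : Type*} [Fintype ι] [DecidableEq ι]

/-- If the sums of the coefficients over `O` of the integer relations between the
`θ i - θ i₀` are never `±1`, then the phases `exp (i t (θ i - θ i₀))` approach simultaneously `1`
outside of `O` and a common value `ζ ≠ 1` in `O`. -/
theorem exists_tendsto_relative_phases (θ : ι → ℝ) (i₀ : ι) (O : Finset ι)
    (h : ∀ l : ι → ℤ, ∑ i, (l i : ℝ) * (θ i - θ i₀) = 0 →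
      ∑ i ∈ O, l i ≠ 1 ∧ ∑ i ∈ O, l i ≠ -1) :
    ∃ (t : ℕ → ℝ) (ζ : ℂ), ζ ≠ 1 ∧ ‖ζ‖ = 1 ∧ ∀ i, Tendsto
      (fun k => Complex.exp (Complex.I * t k * ((θ i - θ i₀ : ℝ) : ℂ))) atTop
      (𝓝 (if i ∈ O then ζ else 1)) := by
  let φ : (ι → ℤ) →+ ℝ :=
    { toFun := fun l => ∑ i, (l i : ℝ) * (θ i - θ i₀)
      map_zero' := by simp
      map_add' := by intro l m; simp [add_mul, Finset.sum_add_distrib] }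
  let ψ : (ι → ℤ) →+ ℤ :=
    { toFun := fun l => ∑ i ∈ O, l i
      map_zero' := by simp
      map_add' := by intro l m; simp [Finset.sum_add_distrib] }
  obtain ⟨N, hN, hdvd⟩ := exists_two_le_dvd_of_one_notMem (φ.ker.map ψ) (by
    rintro ⟨l, hl, hl1⟩
    exact (h l hl).1 hl1)
  have hN0 : (N : ℂ) ≠ 0 := Nat.cast_ne_zero.mpr (by omega)
  have hN0' : (N : ℝ) ≠ 0 := Nat.cast_ne_zero.mpr (by omega)
  have hpi : (2 * Real.pi : ℝ) ≠ 0 := by positivity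
  -- The target is `1/N` on `O` and `0` elsewhere: a relation has coefficient sum `N m` over `O`, so
  -- it pairs with the target to the integer `m`.
  obtain ⟨t, ht⟩ := exists_tendsto_torusPoint (fun i => (θ i - θ i₀) / (2 * Real.pi))
    (fun i => if i ∈ O then (N : ℝ)⁻¹ else 0) (by
      intro l hl
      have hl0 : φ l = 0 := by
        change ∑ i, (l i : ℝ) * (θ i - θ i₀) = 0
        simp only [← mul_div_assoc, ← Finset.sum_div] at hl
        exact (div_eq_zero_iff.mp hl).resolve_right hpi
      obtain ⟨m, hm⟩ := hdvd (ψ l) ⟨l, hl0, rfl⟩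
      refine ⟨m, ?_⟩
      have hm' : ∑ i ∈ O, (l i : ℝ) = N * m := by exact_mod_cast hm
      simp only [mul_ite, mul_zero, Finset.sum_ite_mem, Finset.univ_inter]
      rw [← Finset.sum_mul, hm']
      field_simp)
  have hprim := Complex.isPrimitiveRoot_exp N (by omega)
  refine ⟨t, Complex.exp (2 * Real.pi * Complex.I / N), hprim.ne_one (by omega),
    hprim.norm'_eq_one (by omega), fun i => ?_⟩
  have hi := (((fourier 1 : C(UnitAddCircle, ℂ)).continuous.comp
    (continuous_apply i)).tendsto _).comp ht
  convert hi using 2 with k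
  · simp only [Function.comp_apply, torusPoint, fourier_coe_apply]
    congr 1
    simp
    field_simp
  · simp only [Function.comp_apply, torusPoint, fourier_coe_apply]
    split_ifs
    · congr 1
      simp
      field_simp
    · simp

/-- Simultaneous approximation of phases: those with index outside of `O` approach a common value
`p`, and those with index in `O` a common value `q ≠ p`. -/
theorem exists_tendsto_phases (θ : ι → ℝ) (i₀ : ι) (O : Finset ι)
    (h : ∀ l : ι → ℤ, ∑ i, (l i : ℝ) * (θ i - θ i₀) = 0 →
      ∑ i ∈ O, l i ≠ 1 ∧ ∑ i ∈ O, l i ≠ -1) :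
    ∃ (t : ℕ → ℝ) (p q : ℂ), p ≠ q ∧ ‖p‖ = 1 ∧ ‖q‖ = 1 ∧ ∀ i, Tendsto
      (fun k => Complex.exp (Complex.I * t k * (θ i : ℂ))) atTop (𝓝 (if i ∈ O then q else p)) := by
  obtain ⟨t, ζ, hζ, hζn, ht⟩ := exists_tendsto_relative_phases θ i₀ O h
  -- Only relative phases are controlled so far. Compactness of the circle makes the phase at `i₀`
  -- converge along a subsequence, which fixes `p`.
  have hmem : ∀ k, Complex.exp (Complex.I * t k * (θ i₀ : ℂ)) ∈ Metric.sphere (0 : ℂ) 1 := by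
    intro k
    rw [mem_sphere_zero_iff_norm, show Complex.I * t k * (θ i₀ : ℂ)
      = ((t k * θ i₀ : ℝ) : ℂ) * Complex.I by push_cast; ring, Complex.norm_exp_ofReal_mul_I]
  obtain ⟨p, hp, φ, hφ, hlim⟩ := (isCompact_sphere (0 : ℂ) 1).tendsto_subseq hmem
  rw [mem_sphere_zero_iff_norm] at hp
  have hp0 : p ≠ 0 := by rintro rfl; simp at hp
  refine ⟨t ∘ φ, p, p * ζ, ?_, hp, by rw [norm_mul, hp, hζn, one_mul], fun i => ?_⟩
  · intro e
    exact hζ (mul_left_cancel₀ hp0 (by rw [← e, mul_one]))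
  · have := hlim.mul ((ht i).comp hφ.tendsto_atTop)
    convert this using 2 with k
    · simp only [Function.comp_apply]
      rw [← Complex.exp_add]
      congr 1
      push_cast
      ring
    · split_ifs <;> simp

variable {G : Type*} [Group G] [Fintype G] [DecidableEq G] {S : Finset G}
  {d : ι → ℕ} {ρ : ∀ i, G →* Matrix (Fin (d i)) (Fin (d i)) ℂ}

/-- The criterion for fractional revival from `u` to `u z`, for a central element `z` that acts
by `-1` in the representations with index in `O` and trivially in the others. -/
theorem pgfr_iff (hone : 1 ∉ S) (hinv : ∀ s ∈ S, s⁻¹ ∈ S) (hd : ∀ i, d i ≠ 0)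
    (hρ : ∀ i, ∑ s ∈ S, ρ i s = cayleyEigenvalue S (ρ i) • (1 : Matrix (Fin (d i)) (Fin (d i)) ℂ))
    (hreg : ∀ x, ∑ i, (d i : ℂ) * (ρ i x).trace = if x = 1 then (Fintype.card G : ℂ) else 0)
    {z : G} (hz : z ≠ 1) {O : Finset ι}
    (hO : ∀ i, ρ i z = (if i ∈ O then -1 else 1 : ℂ) • 1) {i₀ : ι} (hi₀ : i₀ ∉ O) (u : G) :
    AdmitsPGFR (cayleyGraph S) u (u * z) ↔
      ∀ l : ι → ℤ, ∑ i, (l i : ℂ) * (cayleyEigenvalue S (ρ i) - cayleyEigenvalue S (ρ i₀)) = 0 →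
        ∑ i ∈ O, l i ≠ 1 ∧ ∑ i ∈ O, l i ≠ -1 := by
  have hreal : ∀ i, ((cayleyEigenvalue S (ρ i)).re : ℂ) = cayleyEigenvalue S (ρ i) := fun i =>
    Complex.conj_eq_iff_re.mp (conj_cayleyEigenvalue hone hinv (hd i) (hρ i))
  constructor
  · rintro ⟨-, t, α, β, -, hβ, hlim⟩ l hl
    rw [tendsto_transitionMatrix_iff hone hinv hd hρ hreg hO] at hlim
    have hunit : ∀ i, ‖α + β * (if i ∈ O then -1 else 1 : ℂ)‖ = 1 := by
      intro i
      refine tendsto_nhds_unique (hlim i).norm (tendsto_const_nhds.congr fun k => ?_)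
      rw [← hreal, show Complex.I * t k * ((cayleyEigenvalue S (ρ i)).re : ℂ)
        = ((t k * (cayleyEigenvalue S (ρ i)).re : ℝ) : ℂ) * Complex.I by push_cast; ring,
        Complex.norm_exp_ofReal_mul_I]
    have hne : ∀ i, α + β * (if i ∈ O then -1 else 1 : ℂ) ≠ 0 := fun i e => by
      have := hunit i
      rw [e, norm_zero] at this
      exact zero_ne_one this
    have h0 := hlim i₀
    have hp0 : α + β ≠ 0 := by simpa [hi₀] using hne i₀
    rw [if_neg hi₀, mul_one] at h0
    -- The relation makes this product of powers of phase ratios equal to `1` for every `k`, hence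
    -- also in the limit.
    have hprod := tendsto_finsetProd Finset.univ fun i _ =>
      (((hlim i).div h0 hp0).zpow₀ (l i) (Or.inl (div_ne_zero (hne i) hp0)))
    have hconst : ∀ k, ∏ i, (Complex.exp (Complex.I * t k * cayleyEigenvalue S (ρ i)) /
        Complex.exp (Complex.I * t k * cayleyEigenvalue S (ρ i₀))) ^ l i = 1 := by
      intro k
      simp only [← Complex.exp_sub, ← Complex.exp_int_mul, ← Complex.exp_sum]
      rw [show ∑ i, (l i : ℂ) * (Complex.I * t k * cayleyEigenvalue S (ρ i)
        - Complex.I * t k * cayleyEigenvalue S (ρ i₀)) = Complex.I * t k * ∑ i, (l i : ℂ) *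
          (cayleyEigenvalue S (ρ i) - cayleyEigenvalue S (ρ i₀)) by
            rw [Finset.mul_sum]; exact Finset.sum_congr rfl fun i _ => by ring,
        hl, mul_zero, Complex.exp_zero]
    have hone' : ∏ i, ((α + β * (if i ∈ O then -1 else 1 : ℂ)) / (α + β)) ^ l i = 1 :=
      tendsto_nhds_unique hprod (tendsto_const_nhds.congr fun k => (hconst k).symm)
    have hζ : ((α - β) / (α + β)) ^ (∑ i ∈ O, l i) = 1 := by
      have hq0 : (α - β) / (α + β) ≠ 0 ∨ O = ∅ := by
        rcases O.eq_empty_or_nonempty with e | ⟨j, hj⟩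
        · exact Or.inr e
        · refine Or.inl (div_ne_zero ?_ hp0)
          simpa [hj, ← sub_eq_add_neg] using hne j
      rcases hq0 with hq0 | rfl
      · rw [zpow_sum_of_ne_zero hq0, ← hone', ← Finset.prod_subset (Finset.subset_univ O)]
        · refine Finset.prod_congr rfl fun i hi => ?_
          rw [if_pos hi, mul_neg_one, sub_eq_add_neg]
        · intro i _ hi
          rw [if_neg hi, mul_one, div_self hp0, one_zpow]
      · simp
    have hfalse : (α - β) / (α + β) ≠ 1 := by
      intro e
      rw [div_eq_one_iff_eq hp0] at e
      exact hβ (by linear_combination (-1 / 2 : ℂ) * e)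
    constructor <;> intro e <;> rw [e] at hζ
    · exact hfalse (by simpa using hζ)
    · exact hfalse (by simpa [zpow_neg, -inv_div] using hζ)
  · intro h
    obtain ⟨t, p, q, hpq, hp, hq, hlim⟩ := exists_tendsto_phases
      (fun i => (cayleyEigenvalue S (ρ i)).re) i₀ O (by
        intro l hl
        refine h l ?_
        have := congr_arg (fun r : ℝ => (r : ℂ)) hl
        push_cast at this
        simpa only [hreal] using this)
    -- Solution of `α + β = p`, `α - β = q`; the parallelogram law gives the normalization.
    refine ⟨by simpa [eq_comm] using hz, t, (p + q) / 2, (p - q) / 2, ?_,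
      div_ne_zero (sub_ne_zero.mpr hpq) two_ne_zero, ?_⟩
    · have := parallelogram_law_with_norm ℝ p q
      rw [hp, hq] at this
      rw [norm_div, norm_div, Complex.norm_two]
      linarith
    · rw [tendsto_transitionMatrix_iff hone hinv hd hρ hreg hO]
      intro i
      have := hlim i
      simp only [hreal] at this
      convert this using 2
      split_ifs <;> ring

end Relations

/-! ### Representations of the dicyclic group -/

theorem sum_conj_invariant_commute {G R : Type*} [Group G] [Semiring R] {S : Finset G}
    (hconj : ∀ g : G, ∀ s ∈ S, g * s * g⁻¹ ∈ S) (ρ : G →* R) (g : G) :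
    ρ g * ∑ s ∈ S, ρ s = (∑ s ∈ S, ρ s) * ρ g := by
  rw [Finset.mul_sum, Finset.sum_mul]
  refine Finset.sum_bij' (fun s _ => g * s * g⁻¹) (fun s _ => g⁻¹ * s * g) ?_ ?_ ?_ ?_ ?_
  · exact hconj g
  · intro s hs
    simpa using hconj g⁻¹ s hs
  · intro s _; group
  · intro s _; group
  · intro s _
    rw [← map_mul, ← map_mul]
    congr 1
    group

namespace Dicyclic

open QuaternionGroup

theorem isPrimitiveRoot_omega (n : ℕ) [NeZero n] : IsPrimitiveRoot (omega n) (2 * n) := by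
  have h := Complex.isPrimitiveRoot_exp (2 * n) (NeZero.ne _)
  have hn : (n : ℂ) ≠ 0 := Nat.cast_ne_zero.mpr (NeZero.ne n)
  convert h using 1
  rw [omega]
  congr 1
  push_cast
  field_simp

theorem omega_pow_half (n : ℕ) [NeZero n] : omega n ^ n = -1 := by
  have hn : (n : ℂ) ≠ 0 := Nat.cast_ne_zero.mpr (NeZero.ne n)
  rw [omega, ← Complex.exp_nat_mul, mul_div_cancel₀ _ hn, Complex.exp_pi_mul_I]

/-- Commuting with `b` forces `2k = 0` modulo `2n`, so `k` is `0` or `n`. An element `b a^k`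
commuting with `a` would give `2 = 0` modulo `2n`, impossible for `n ≥ 2`. -/
theorem eq_of_mem_center {n : ℕ} [NeZero n] (hn : 2 ≤ n) {g : QuaternionGroup n}
    (hg : g ∈ Subgroup.center (QuaternionGroup n)) (h1 : g ≠ 1) : g = a n := by
  rw [Subgroup.mem_center_iff] at hg
  rcases g with k | k
  · have h := hg (xa 0)
    simp only [xa_mul_a, a_mul_xa, xa.injEq, zero_add, zero_sub] at h
    have hval : ((2 * k.val : ℕ) : ZMod (2 * n)) = 0 := by
      push_cast
      rw [ZMod.natCast_zmod_val]
      linear_combination h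
    rw [ZMod.natCast_eq_zero_iff] at hval
    have hdvd : n ∣ k.val := Nat.dvd_of_mul_dvd_mul_left two_pos hval
    obtain ⟨c, hc⟩ := hdvd
    have hlt := ZMod.val_lt k
    have hc2 : c < 2 := by
      rw [hc, mul_comm 2 n] at hlt
      exact lt_of_mul_lt_mul_left hlt (Nat.zero_le n)
    interval_cases c
    · exact absurd (by rw [(ZMod.val_eq_zero k).mp (by simpa using hc), a_zero]) h1
    · congr 1
      rw [← ZMod.natCast_zmod_val k, hc, mul_one]
  · have h := hg (a 1)
    simp only [xa_mul_a, a_mul_xa, xa.injEq] at h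
    have h2 : ((2 : ℕ) : ZMod (2 * n)) = 0 := by
      push_cast
      linear_combination -h
    rw [ZMod.natCast_eq_zero_iff] at h2
    have := Nat.le_of_dvd two_pos h2
    omega

theorem a_natCast_ne_one (n : ℕ) [NeZero n] : (a n : QuaternionGroup n) ≠ 1 := by
  rw [one_def, Ne, a.injEq, ZMod.natCast_eq_zero_iff]
  intro h
  have := Nat.le_of_dvd (NeZero.pos n) h
  have := NeZero.pos n
  omega

section Values

variable {n : ℕ} [NeZero n]

theorem linearRep_a {x y : ℂ} (hx : x * x = 1) (hy : y * y = x ^ n) (k : ZMod (2 * n)) :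
    linearRep n x y hx hy (a k) = x ^ k.val • 1 := by
  change (Matrix.diagonal fun _ : Fin 1 => x) ^ k.val = _
  rw [Matrix.diagonal_pow, Matrix.smul_one_eq_diagonal]
  rfl

theorem linearRep_xa {x y : ℂ} (hx : x * x = 1) (hy : y * y = x ^ n) (k : ZMod (2 * n)) :
    linearRep n x y hx hy (xa k) = (y * x ^ k.val) • 1 := by
  change (Matrix.diagonal fun _ : Fin 1 => y) * (Matrix.diagonal fun _ : Fin 1 => x) ^ k.val = _
  rw [Matrix.diagonal_pow, Matrix.diagonal_mul_diagonal, Matrix.smul_one_eq_diagonal]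
  rfl

theorem linearRep_a_natCast {x y : ℂ} (hx : x * x = 1) (hy : y * y = x ^ n) :
    linearRep n x y hx hy (a n) = x ^ n • 1 := by
  rw [linearRep_a, pow_val_natCast]
  rw [pow_mul, pow_two, hx, one_pow]

theorem rho_a (h : ℕ) (k : ZMod (2 * n)) :
    rho n h (a k) = Matrix.diagonal ![(omega n ^ h) ^ k.val, ((omega n ^ h)⁻¹) ^ k.val] := by
  change (Matrix.diagonal ![omega n ^ h, (omega n ^ h)⁻¹]) ^ k.val = _
  rw [Matrix.diagonal_pow]
  congr 1
  ext i
  fin_cases i <;> rfl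

theorem rho_xa (h : ℕ) (k : ZMod (2 * n)) :
    rho n h (xa k) = !![0, 1; omega n ^ (h * n), 0] *
      Matrix.diagonal ![(omega n ^ h) ^ k.val, ((omega n ^ h)⁻¹) ^ k.val] := by
  rw [← rho_a]
  rfl

theorem trace_rho_a (h : ℕ) (k : ZMod (2 * n)) :
    (rho n h (a k)).trace = (omega n ^ h) ^ k.val + ((omega n ^ h)⁻¹) ^ k.val := by
  rw [rho_a, Matrix.trace_diagonal, Fin.sum_univ_two]
  rfl

theorem trace_rho_xa (h : ℕ) (k : ZMod (2 * n)) : (rho n h (xa k)).trace = 0 := by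
  rw [rho_xa, Matrix.trace_fin_two]
  simp [Matrix.mul_apply, Fin.sum_univ_two]

theorem rho_a_natCast (h : ℕ) : rho n h (a n) = ((-1 : ℂ) ^ h) • 1 := by
  have e : (omega n ^ h) ^ (2 * n) = 1 := by rw [pow_right_comm, omega_pow, one_pow]
  rw [rho_a, pow_val_natCast e, pow_val_natCast (by rw [inv_pow, e, inv_one]), inv_pow,
    pow_right_comm, omega_pow_half, ← inv_pow, inv_neg, inv_one, Matrix.smul_one_eq_diagonal]
  congr 1
  ext i
  fin_cases i <;> rfl

end Values

theorem sum_linear_eq_smul_one {G : Type*} [Group G] (S : Finset G)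
    (ρ : G →* Matrix (Fin 1) (Fin 1) ℂ) :
    ∑ s ∈ S, ρ s = cayleyEigenvalue S ρ • (1 : Matrix (Fin 1) (Fin 1) ℂ) := by
  ext i j
  fin_cases i; fin_cases j
  simp [cayleyEigenvalue, Matrix.sum_apply, Matrix.trace]

/-- Schur's lemma by hand: the sum commutes with `ρ_h(a)`, whose diagonal entries differ because `0
< 2h < 2n`, so it is diagonal; commuting with `ρ_h(b)` equates its two diagonal entries. -/
theorem sum_rho_eq_smul_one {n : ℕ} [NeZero n] {S : Finset (QuaternionGroup n)}
    (hconj : ∀ g : QuaternionGroup n, ∀ s ∈ S, g * s * g⁻¹ ∈ S) {h : ℕ} (h0 : 0 < h) (hn : h < n) :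
    ∑ s ∈ S, rho n h s = cayleyEigenvalue S (rho n h) • (1 : Matrix (Fin 2) (Fin 2) ℂ) := by
  set M := ∑ s ∈ S, rho n h s with hM
  have hθ : cayleyEigenvalue S (rho n h) = (1 / 2) * (M 0 0 + M 1 1) := by
    rw [cayleyEigenvalue, ← Matrix.trace_sum, ← hM, Matrix.trace_fin_two]
    norm_num
  have hA := sum_conj_invariant_commute hconj (rho n h) (a 1)
  have hB := sum_conj_invariant_commute hconj (rho n h) (xa 0)
  rw [← hM] at hA hB
  have : Fact (1 < 2 * n) := ⟨by omega⟩
  rw [rho_a, ZMod.val_one, pow_one, pow_one] at hA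
  have hdiag : (Matrix.diagonal ![1, 1] : Matrix (Fin 2) (Fin 2) ℂ) = 1 := by
    rw [← Matrix.diagonal_one]
    congr 1
    ext i
    fin_cases i <;> rfl
  rw [rho_xa, ZMod.val_zero, pow_zero, pow_zero, hdiag, mul_one] at hB
  have hω : omega n ^ h ≠ 0 := pow_ne_zero _ (omega_ne_zero n)
  have hne : omega n ^ h * omega n ^ h ≠ 1 := by
    rw [← pow_add]
    exact (isPrimitiveRoot_omega n).pow_ne_one_of_pos_of_lt (by omega) (by omega)
  have hne' : omega n ^ h ≠ (omega n ^ h)⁻¹ := fun e => hne (by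
    nth_rewrite 2 [e]; exact mul_inv_cancel₀ hω)
  have h01 : M 0 1 = 0 := by
    have := congr_fun (congr_fun hA 0) 1
    simp only [Matrix.diagonal_mul, Matrix.mul_diagonal, Matrix.cons_val_zero,
      Matrix.cons_val_one] at this
    exact (mul_eq_zero.mp (by linear_combination this :
      (omega n ^ h - (omega n ^ h)⁻¹) * M 0 1 = 0)).resolve_left (sub_ne_zero.mpr hne')
  have h10 : M 1 0 = 0 := by
    have := congr_fun (congr_fun hA 1) 0
    simp only [Matrix.diagonal_mul, Matrix.mul_diagonal, Matrix.cons_val_zero,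
      Matrix.cons_val_one] at this
    exact (mul_eq_zero.mp (by linear_combination -this :
      (omega n ^ h - (omega n ^ h)⁻¹) * M 1 0 = 0)).resolve_left (sub_ne_zero.mpr hne')
  have h11 : M 1 1 = M 0 0 := by
    have := congr_fun (congr_fun hB 0) 1
    simpa [Matrix.mul_apply, Fin.sum_univ_two] using this
  rw [hθ, h11]
  ext i j
  fin_cases i <;> fin_cases j <;> simp [h01, h10, h11]
  all_goals ring

/-- The sum of the powers of a `2n`-th root of unity, arranged by mutually inverse pairs. -/
theorem sum_pow_add_inv_pow {n : ℕ} [NeZero n] {η : ℂ} (hη : η ^ (2 * n) = 1) :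
    ∑ h ∈ Finset.Icc 1 (n - 1), (η ^ h + η⁻¹ ^ h) + 1 + η ^ n = ∑ h ∈ Finset.range (2 * n), η ^ h := by
  obtain ⟨m, rfl⟩ : ∃ m, n = m + 1 := ⟨n - 1, by have := NeZero.pos n; omega⟩
  have hIcc : Finset.Icc 1 (m + 1 - 1) = Finset.Ico 1 (m + 1) := by
    ext i; simp only [Finset.mem_Icc, Finset.mem_Ico]; omega
  rw [hIcc, Finset.sum_Ico_eq_sum_range, two_mul, Finset.sum_range_add, Finset.sum_range_succ',
    Finset.sum_range_succ' (fun x => η ^ (m + 1 + x)), Finset.sum_add_distrib,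
    ← Finset.sum_range_reflect (fun x => η ^ (m + 1 + (x + 1)))]
  -- Read backwards, the exponents above `n` are `2n - h` with `h = 1 + i`, and `η^(2n-h) = η^(-h)`.
  -- The exponents `0` and `n` remain unpaired.
  have hrefl : ∑ i ∈ Finset.range m, η ^ (m + 1 + (m - 1 - i + 1))
      = ∑ i ∈ Finset.range m, η⁻¹ ^ (1 + i) := by
    refine Finset.sum_congr rfl fun i hi => ?_
    rw [Finset.mem_range] at hi
    rw [inv_pow]
    refine eq_inv_of_mul_eq_one_left ?_
    rw [← pow_add, ← hη]
    congr 1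
    omega
  rw [hrefl]
  simp only [Nat.add_sub_cancel, add_comm 1, pow_zero, add_zero]
  ring

/-! ### The full family of representations and its regular character -/

section Family

variable (n : ℕ)

/-- Indices of the irreducible representations: four of degree one, and `h = 1, …, n - 1`. -/
abbrev RepIndex : Type := Fin 4 ⊕ Finset.Icc 1 (n - 1)

/-- The degree of an irreducible representation. -/
def repDegree : RepIndex n → ℕ
  | .inl _ => 1
  | .inr _ => 2

/-- The irreducible representations of the dicyclic group. -/
noncomputable def irrep [NeZero n] : ∀ i : RepIndex n,
    QuaternionGroup n →* Matrix (Fin (repDegree n i)) (Fin (repDegree n i)) ℂ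
  | .inl i => ![psi₁ n, psi₂ n, psi₃ n, psi₄ n] i
  | .inr h => rho n h

/-- The representations in which `a ^ n` acts by `-1`. -/
def negativeReps : Finset (RepIndex n) :=
  (if Odd n then {2, 3} else ∅ : Finset (Fin 4)).disjSum
    (Finset.univ.filter fun h => Odd (h : ℕ))

variable {n}

theorem repDegree_ne_zero (i : RepIndex n) : repDegree n i ≠ 0 := by
  rcases i with i | i <;> simp [repDegree]

theorem sum_negativeReps (l : RepIndex n → ℤ) :
    ∑ i ∈ negativeReps n, l i = (if Odd n then l (.inl 2) + l (.inl 3) else 0)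
      + ∑ h : Finset.Icc 1 (n - 1), if Odd (h : ℕ) then l (.inr h) else 0 := by
  rw [negativeReps, Finset.sum_disjSum, Finset.sum_filter]
  congr 1
  by_cases h : Odd n <;> simp [h]

variable [NeZero n]

theorem sum_irrep_eq_smul_one {S : Finset (QuaternionGroup n)}
    (hconj : ∀ g : QuaternionGroup n, ∀ s ∈ S, g * s * g⁻¹ ∈ S) (i : RepIndex n) :
    ∑ s ∈ S, irrep n i s = cayleyEigenvalue S (irrep n i) •
      (1 : Matrix (Fin (repDegree n i)) (Fin (repDegree n i)) ℂ) := by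
  rcases i with i | ⟨h, hh⟩
  · exact sum_linear_eq_smul_one S _
  · obtain ⟨h1, h2⟩ := Finset.mem_Icc.mp hh
    exact sum_rho_eq_smul_one hconj (show 0 < h by omega) (show h < n by omega)

theorem irrep_a_natCast (i : RepIndex n) :
    irrep n i (a n) = (if i ∈ negativeReps n then -1 else 1 : ℂ) • 1 := by
  have hsign : ∀ m : ℕ, (-1 : ℂ) ^ m = if Odd m then -1 else 1 := by
    intro m
    split_ifs with hm
    · exact hm.neg_one_pow
    · exact (Nat.not_odd_iff_even.mp hm).neg_one_pow
  have hscalar : ∀ {c : ℂ}, irrep n i (a n) = c • 1 →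
      c = (if i ∈ negativeReps n then -1 else 1 : ℂ) →
      irrep n i (a n) = (if i ∈ negativeReps n then -1 else 1 : ℂ) • 1 := by
    rintro c h rfl
    exact h
  -- Counting from zero, `2` and `3` stand for `ψ₃` and `ψ₄`, where `a^n` acts by `(-1)^n`.
  have hlin : ∀ j : Fin 4, (Sum.inl j : RepIndex n) ∈ negativeReps n ↔
      Odd n ∧ (j = 2 ∨ j = 3) := by
    intro j
    rw [negativeReps, Finset.inl_mem_disjSum]
    split_ifs with h <;> simp [h]
  rcases i with i | h
  · fin_cases i
    · exact hscalar (linearRep_a_natCast (x := 1) (y := 1) (by simp) (by simp)) (by simp [hlin])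
    · exact hscalar (linearRep_a_natCast (x := 1) (y := -1) (by simp) (by simp)) (by simp [hlin])
    · exact hscalar (linearRep_a_natCast (x := -1) (y := eps n) (by simp) (eps_mul_eps n))
        (by simp [hlin, hsign])
    · exact hscalar (linearRep_a_natCast (x := -1) (y := -eps n) (by simp)
        (by rw [neg_mul_neg, eps_mul_eps])) (by simp [hlin, hsign])
  · exact hscalar (rho_a_natCast (h : ℕ)) (by simp [negativeReps, hsign])

/-- This identity is all the completeness that is needed; irreducibility is never used. At `b a^k`
the linear characters cancel in pairs and the traces of `ρ_h` vanish. At `a^k` the sum is twice the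
geometric sum of `ω^k` over `2n` exponents. -/
theorem sum_degree_mul_trace_irrep (x : QuaternionGroup n) :
    ∑ i, (repDegree n i : ℂ) * (irrep n i x).trace
      = if x = 1 then (Fintype.card (QuaternionGroup n) : ℂ) else 0 := by
  have hsplit : ∑ i, (repDegree n i : ℂ) * (irrep n i x).trace
      = (psi₁ n x).trace + (psi₂ n x).trace + (psi₃ n x).trace + (psi₄ n x).trace
        + ∑ h ∈ Finset.Icc 1 (n - 1), 2 * (rho n h x).trace := by
    rw [Fintype.sum_sum_type, Fin.sum_univ_four,
      ← Finset.sum_coe_sort _ fun h => 2 * (rho n h x).trace]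
    congr 1
    simp only [repDegree, Nat.cast_one, one_mul]
    rfl
  rw [hsplit, QuaternionGroup.card]
  rcases x with k | k
  · simp only [psi₁, psi₂, psi₃, psi₄, linearRep_a, trace_rho_a, Matrix.trace_smul,
      Matrix.trace_one, Fintype.card_fin]
    set η : ℂ := omega n ^ k.val with hη
    have hη1 : η ^ (2 * n) = 1 := by rw [hη, pow_right_comm, omega_pow, one_pow]
    have hηn : η ^ n = (-1) ^ k.val := by rw [hη, pow_right_comm, omega_pow_half]
    have hsum : ∑ h ∈ Finset.Icc 1 (n - 1),
        2 * ((omega n ^ h) ^ k.val + ((omega n ^ h)⁻¹) ^ k.val)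
        = 2 * ∑ h ∈ Finset.Icc 1 (n - 1), (η ^ h + η⁻¹ ^ h) := by
      rw [Finset.mul_sum]
      refine Finset.sum_congr rfl fun h _ => ?_
      rw [hη, pow_right_comm, inv_pow, inv_pow, pow_right_comm]
    have hgeom : ∑ h ∈ Finset.range (2 * n), η ^ h = if k = 0 then (2 * n : ℂ) else 0 := by
      split_ifs with hk
      · simp [hη, hk]
      · have hne : η ≠ 1 := (isPrimitiveRoot_omega n).pow_ne_one_of_pos_of_lt
          (by simpa using hk) (ZMod.val_lt k)
        rw [geom_sum_eq hne, hη1, sub_self, zero_div]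
    have hpair := sum_pow_add_inv_pow hη1
    rw [hgeom, hηn] at hpair
    rw [hsum]
    by_cases hk : k = 0
    · rw [if_pos hk] at hpair
      rw [if_pos (by rw [hk, a_zero])]
      simp only [one_pow, smul_eq_mul]
      push_cast
      linear_combination 2 * hpair
    · rw [if_neg hk] at hpair
      rw [if_neg (by rwa [one_def, a.injEq])]
      simp only [one_pow, smul_eq_mul]
      push_cast
      linear_combination 2 * hpair
  · simp only [psi₁, psi₂, psi₃, psi₄, linearRep_xa, trace_rho_xa, Matrix.trace_smul,
      Matrix.trace_one, Fintype.card_fin]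
    simp [one_def, -a_zero]

/-- Pretty good fractional revival from `u` to `u a ^ n` in terms of the integer relations between
the eigenvalues of the dicyclic Cayley graph. -/
theorem pgfr_mul_iff {S : Finset (QuaternionGroup n)}
    (hone : 1 ∉ S) (hinv : ∀ s ∈ S, s⁻¹ ∈ S)
    (hconj : ∀ g : QuaternionGroup n, ∀ s ∈ S, g * s * g⁻¹ ∈ S) (u : QuaternionGroup n) :
    AdmitsPGFR (cayleyGraph S) u (u * a n) ↔
      ∀ (l₂ l₃ l₄ : ℤ) (l : ℕ → ℤ), IsEigenvalueRelation n S l₂ l₃ l₄ l →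
        (if Odd n then l₃ + l₄ else 0) + oddSum n l ≠ 1 ∧
          (if Odd n then l₃ + l₄ else 0) + oddSum n l ≠ -1 := by
  have h0 : (Sum.inl 0 : RepIndex n) ∉ negativeReps n := by
    rw [negativeReps, Finset.inl_mem_disjSum]
    split_ifs <;> simp
  rw [pgfr_iff hone hinv repDegree_ne_zero (sum_irrep_eq_smul_one hconj)
    sum_degree_mul_trace_irrep (a_natCast_ne_one n) irrep_a_natCast h0]
  have hrel : ∀ l : RepIndex n → ℤ, ∑ i, (l i : ℂ) *
      (cayleyEigenvalue S (irrep n i) - cayleyEigenvalue S (irrep n (Sum.inl 0)))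
      = (l (.inl 1) : ℂ) * (cayleyEigenvalue S (psi₂ n) - cayleyEigenvalue S (psi₁ n))
        + (l (.inl 2) : ℂ) * (cayleyEigenvalue S (psi₃ n) - cayleyEigenvalue S (psi₁ n))
        + (l (.inl 3) : ℂ) * (cayleyEigenvalue S (psi₄ n) - cayleyEigenvalue S (psi₁ n))
        + ∑ h : Finset.Icc 1 (n - 1), (l (.inr h) : ℂ) *
          (cayleyEigenvalue S (rho n h) - cayleyEigenvalue S (psi₁ n)) := by
    intro l
    rw [Fintype.sum_sum_type, Fin.sum_univ_four, sub_self, mul_zero, zero_add]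
    rfl
  constructor
  · intro H l₂ l₃ l₄ l hl
    -- The coefficient of `ψ₁` is arbitrary: it multiplies `λ₁ - λ₁`, and `ψ₁` is not in
    -- `negativeReps`.
    have := H (Sum.elim ![0, l₂, l₃, l₄] fun h => l h) (by
      rw [hrel, ← hl, ← Finset.sum_coe_sort (Finset.Icc 1 (n - 1))]
      rfl)
    rw [sum_negativeReps] at this
    rw [oddSum, Finset.sum_filter, ← Finset.sum_coe_sort]
    exact this
  · intro H l hl
    set l' : ℕ → ℤ := fun h => if hh : h ∈ Finset.Icc 1 (n - 1) then l (.inr ⟨h, hh⟩) else 0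
      with hl'
    have hval : ∀ h : Finset.Icc 1 (n - 1), l' h = l (.inr h) := fun h => dif_pos h.2
    have := H (l (.inl 1)) (l (.inl 2)) (l (.inl 3)) l' (by
      rw [IsEigenvalueRelation, ← Finset.sum_coe_sort]
      simp only [hval]
      rw [← hrel, hl])
    rw [oddSum, Finset.sum_filter, ← Finset.sum_coe_sort] at this
    simp only [hval] at this
    rwa [sum_negativeReps]

end Family

end Dicyclic

theorem mainTheorem1 (n : ℕ) [NeZero n] (hn : 2 ≤ n) (S : Finset (QuaternionGroup n))
    (hone : 1 ∉ S) (hinv : ∀ s ∈ S, s⁻¹ ∈ S)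
    (hconj : ∀ g : QuaternionGroup n, ∀ s ∈ S, g * s * g⁻¹ ∈ S) :
    (∀ u v : QuaternionGroup n, AdmitsPGFR (cayleyGraph S) u v →
      u⁻¹ * v ∈ Subgroup.zpowers (QuaternionGroup.a 1 : QuaternionGroup n) ∧
        v = u * QuaternionGroup.a 1 ^ n) ∧
    (Odd n → ∀ u v : QuaternionGroup n, v = u * QuaternionGroup.a 1 ^ n →
      (AdmitsPGFR (cayleyGraph S) u v ↔
        ∀ (l₂ l₃ l₄ : ℤ) (l : ℕ → ℤ), Dicyclic.IsEigenvalueRelation n S l₂ l₃ l₄ l →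
          l₃ + l₄ + Dicyclic.oddSum n l ≠ 1 ∧ l₃ + l₄ + Dicyclic.oddSum n l ≠ -1)) ∧
    (Even n → ∀ u v : QuaternionGroup n, v = u * QuaternionGroup.a 1 ^ n →
      (AdmitsPGFR (cayleyGraph S) u v ↔
        ∀ (l₂ l₃ l₄ : ℤ) (l : ℕ → ℤ), Dicyclic.IsEigenvalueRelation n S l₂ l₃ l₄ l →
          Dicyclic.oddSum n l ≠ 1 ∧ Dicyclic.oddSum n l ≠ -1)) := by
  refine ⟨fun u v h => ?_, ?_, ?_⟩
  · have hne : u⁻¹ * v ≠ 1 := fun e => h.1 (inv_mul_eq_one.mp e)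
    have hv : u⁻¹ * v = QuaternionGroup.a 1 ^ n := by
      rw [QuaternionGroup.a_one_pow]
      exact Dicyclic.eq_of_mem_center hn (h.mem_center hone hinv hconj) hne
    exact ⟨hv ▸ Subgroup.npow_mem_zpowers _ n, inv_mul_eq_iff_eq_mul.mp hv⟩
  · rintro hodd u v rfl
    rw [QuaternionGroup.a_one_pow, Dicyclic.pgfr_mul_iff hone hinv hconj]
    simp only [if_pos hodd]
  · rintro heven u v rfl
    rw [QuaternionGroup.a_one_pow, Dicyclic.pgfr_mul_iff hone hinv hconj]
    simp only [if_neg (Nat.not_odd_iff_even.mpr heven), zero_add]
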